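/- Let $\mathcal S^2=\{x\in\mathbb R^3:\|x\|=1\}$, with geodesic distance $d_{\mathcal S^2}(x,y)=\arccos(x^Ty)$. Equip $(\mathcal S^2)^2$ with the distance $d(\Gamma,\bar\Gamma)=\max_{i}d_{\mathcal S^2}(\Gamma_i,\bar\Gamma_i)$ and with the product of the surface measures, and let $d_{\mathcal M}(\Gamma)=\inf_{\bar\Gamma\in\mathcal M}d(\Gamma,\bar\Gamma)$ for $\mathcal M\subset(\mathcal S^2)^2$. Consider $n=2$ agents, indexed modulo $2$, with reduced attitudes $\Gamma_1,\Gamma_2\in\mathcal S^2$ that evolve according to the closed-loop system $$\dot\Gamma_i=\Gamma_i\times\sum_{j\in\mathcal N_i}\Gamma_i\times\Gamma_j,\qquad i=1,2,\quad t\ge 0,$$ where the inter-agent graph is either the undirected ring, $\mathcal N_i=\{i-1,i+1\}$ for all $i$, or the directed ring, $\mathcal N_i=\{i+1\}$ for all $i$ (the $\mathcal N_i$ are sets of agents). Let $\mathcal M_e=\{\Gamma\in(\mathcal S^2)^2:\Gamma_i=(-1)^{i-1}v,\ i=1,2,\text{ for some }v\in\mathcal S^2\}$. The region of attraction of $\mathcal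 M_e$ is the set of initial states from which a trajectory on $[0,\infty)$ exists and from which every trajectory satisfies $d_{\mathcal M_e}(\Gamma(t))\to0$ as $t\to\infty$. Then, under either ring graph, $\mathcal M_e=\{\Gamma:\Gamma_1=-\Gamma_2\}$, and $\mathcal M_e$ is almost globally asymptotically stable, that is: 1. (stability) for every $\varepsilon>0$ there is $\delta>0$ such that every trajectory with $d_{\mathcal M_e}(\Gamma(0))<\delta$ satisfies $d_{\mathcal M_e}(\Gamma(t))<\varepsilon$ for all $t\ge0$; 2. (attractivity) for some $\delta>0$ all states $\Gamma$ with $d_{\mathcal M_e}(\Gamma)<\delta$ belong to the region of attraction of $\mathcal M_e$; 3. the complement of the region of attraction of $\mathcal M_e$ has measure zero. Moreover, the region of attraction contains $\{\Gamma\in(\mathcal S^2)^2:\Gamma_1\ne\Gamma_2\}$, whose complement has measure zero. -/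

import Mathlib

open Set Filter Topology MeasureTheory

noncomputable section

namespace ReducedAttitude

/-- Euclidean three-space. -/
abbrev E3 : Type := EuclideanSpace ℝ (Fin 3)

/-- The unit sphere of `ℝ³`. -/
abbrev S2 : Type := Metric.sphere (0 : E3) 1

/-- The state space `(S²)ⁿ`; agent `i ∈ {1, …, n}` is the index `i - 1` of `Fin n`, so that
addition and subtraction of indices is modulo `n`. -/
abbrev State (n : ℕ) : Type := Fin n → S2

/-- The cross product `x × y` on `ℝ³`, that is, the hat operator of `x` applied to `y`. -/
def cross (x y : E3) : E3 :=
  WithLp.toLp 2 (crossProduct (WithLp.ofLp x) (WithLp.ofLp y))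

/-- Geodesic (great-circle) distance on the sphere, with values in `[0, π]`. -/
def geoDist (x y : S2) : ℝ := Real.arccos (inner ℝ (x : E3) (y : E3))

/-- The distance on `(S²)ⁿ`: maximum over the agents of the geodesic distances. -/
def stateDist {n : ℕ} (Γ Γ' : State n) : ℝ := ⨆ i, geoDist (Γ i) (Γ' i)

/-- The distance of a state to a (non-empty) set of states. -/
def distTo {n : ℕ} (M : Set (State n)) (Γ : State n) : ℝ := ⨅ Γ' : M, stateDist Γ Γ'

open Classical in
/-- The set `N_i` of neighbours of `i`: all `j` with an edge `(j, i)`. -/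
def nbrs {n : ℕ} (G : Digraph (Fin n)) (i : Fin n) : Finset (Fin n) :=
  Finset.univ.filter fun j => G.Adj j i

/-- Undirected ring: `N_i = {i - 1, i + 1}` for every agent. -/
def IsUndirectedRing {n : ℕ} [NeZero n] (G : Digraph (Fin n)) : Prop :=
  ∀ i, nbrs G i = {i - 1, i + 1}

/-- Directed ring: `N_i = {i + 1}` for every agent. -/
def IsDirectedRing {n : ℕ} [NeZero n] (G : Digraph (Fin n)) : Prop :=
  ∀ i, nbrs G i = {i + 1}

/-- Right-hand side of the closed-loop system: the `i`-th component is
`Γ_i × ∑_{j ∈ N_i} Γ_i × Γ_j`. This is `ω_i × Γ_i` for the angular velocity control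
`ω_i = -∑_{j ∈ N_i} Γ_i × Γ_j`. -/
def closedLoopField {n : ℕ} (G : Digraph (Fin n)) (x : Fin n → E3) : Fin n → E3 :=
  fun i => cross (x i) (∑ j ∈ nbrs G i, cross (x i) (x j))

/-- `γ`, restricted to `[0, ∞)`, is a trajectory of the closed-loop system on `(S²)ⁿ`. -/
def IsTrajectory {n : ℕ} (G : Digraph (Fin n)) (γ : ℝ → State n) : Prop :=
  IsIntegralCurveOn (fun t i => (γ t i : E3)) (fun _ x => closedLoopField G x) (Ici 0)

/-- Lyapunov stability of a set of states. -/
def IsStableSet {n : ℕ} (G : Digraph (Fin n)) (M : Set (State n)) : Prop :=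
  ∀ ε > 0, ∃ δ > 0, ∀ γ : ℝ → State n, IsTrajectory G γ →
    distTo M (γ 0) < δ → ∀ t, 0 ≤ t → distTo M (γ t) < ε

/-- Region of attraction of `M`: the initial states from which a trajectory for all times `t ≥ 0`
exists and from which every trajectory converges to `M`. -/
def regionOfAttraction {n : ℕ} (G : Digraph (Fin n)) (M : Set (State n)) : Set (State n) :=
  {Γ₀ | (∃ γ : ℝ → State n, IsTrajectory G γ ∧ γ 0 = Γ₀) ∧
    ∀ γ : ℝ → State n, IsTrajectory G γ → γ 0 = Γ₀ →
      Tendsto (fun t => distTo M (γ t)) atTop (𝓝 0)}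

/-- Asymptotic stability of a set: stability, and attraction of all states close to the set. -/
def IsAsymptoticallyStable {n : ℕ} (G : Digraph (Fin n)) (M : Set (State n)) : Prop :=
  IsStableSet G M ∧ ∃ δ > 0, ∀ Γ : State n, distTo M Γ < δ → Γ ∈ regionOfAttraction G M

/-- The product on `(S²)ⁿ` of the surface measures of the spheres. -/
def stateMeasure (n : ℕ) : Measure (State n) :=
  Measure.pi fun _ => (volume : Measure E3).toSphere

/-- Almost global asymptotic stability: asymptotic stability, with a region of attraction whose
complement has measure zero. -/
def IsAlmostGloballyAsymptoticallyStable {n : ℕ} (G : Digraph (Fin n)) (M : Set (State n)) :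
    Prop :=
  IsAsymptoticallyStable G M ∧ stateMeasure n (regionOfAttraction G M)ᶜ = 0

/-- The antipodal formation manifold `M_e` (for even `n`): `Γ_i = (-1)^(i-1) v` for all agents
`i ∈ {1, …, n}` and some point `v` of the sphere. -/
def antipodalSet (n : ℕ) : Set (State n) :=
  {Γ | ∃ v : S2, ∀ i : Fin n, (Γ i : E3) = (-1 : ℝ) ^ (i : ℕ) • (v : E3)}

end ReducedAttitude

end

open Set Filter Topology MeasureTheory
open scoped Pointwise

namespace ReducedAttitude

/-! For two agents both rings give each agent the other as sole neighbour, and the field is `⟪Γ₁,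
Γ₂⟫ Γᵢ - Γⱼ`, the tangential part of `-Γⱼ`. Hence `c = ⟪Γ₁, Γ₂⟫` obeys the closed scalar equation
`c' = -2 (1 - c²)`: it never increases, and it tends to `-1` unless it starts at `1`, that is,
unless the agents coincide (`IsTrajectory.tendsto_cosAngle`). The angle `arccos (-c)` from `Γ₁` to
`-Γ₂` is at least the distance to the antipodal set and at most twice it, so the behaviour of `c`
gives both stability and attraction. Trajectories exist by an explicit formula
(`exists_isTrajectory`), and the diagonal is null by Fubini. -/

theorem cross_cross_self {x y : E3} (hx : ‖x‖ = 1) :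
    cross x (cross x y) = inner ℝ x y • x - y := by
  have h : x 0 * x 0 + x 1 * x 1 + x 2 * x 2 = 1 := by
    have h1 := EuclideanSpace.real_norm_sq_eq x
    rw [hx, Fin.sum_univ_three] at h1
    linarith
  ext i
  fin_cases i <;> simp [cross, cross_apply, PiLp.inner_apply, Fin.sum_univ_three]
  · linear_combination (-y 0) * h
  · linear_combination (-y 1) * h
  · linear_combination (-y 2) * h

/-- Modulo 2, `i - 1 = i + 1`, so the two neighbours of the undirected ring merge into one. -/
theorem nbrs_eq_of_isRing {G : Digraph (Fin 2)} (hG : IsUndirectedRing G ∨ IsDirectedRing G)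
    (i : Fin 2) : nbrs G i = {i + 1} := by
  rcases hG with hG | hG
  · rw [hG i]
    fin_cases i <;> rfl
  · exact hG i

theorem closedLoopField_apply {G : Digraph (Fin 2)} (hG : ∀ i, nbrs G i = {i + 1})
    {x : Fin 2 → E3} (hx : ∀ i, ‖x i‖ = 1) (i : Fin 2) :
    closedLoopField G x i = inner ℝ (x i) (x (i + 1)) • x i - x (i + 1) := by
  rw [closedLoopField, hG i, Finset.sum_singleton, cross_cross_self (hx i)]

theorem isTrajectory_iff {G : Digraph (Fin 2)} (hG : ∀ i, nbrs G i = {i + 1})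
    {γ : ℝ → State 2} : IsTrajectory G γ ↔ ∀ t ∈ Ici (0 : ℝ),
      HasDerivWithinAt (fun s => (γ s 0 : E3))
        (inner ℝ (γ t 0 : E3) (γ t 1 : E3) • (γ t 0 : E3) - γ t 1) (Ici 0) t ∧
      HasDerivWithinAt (fun s => (γ s 1 : E3))
        (inner ℝ (γ t 0 : E3) (γ t 1 : E3) • (γ t 1 : E3) - γ t 0) (Ici 0) t := by
  refine forall₂_congr fun t _ => ?_
  have hx : ∀ i, ‖((γ t i : S2) : E3)‖ = 1 := fun i => norm_eq_of_mem_sphere _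
  rw [hasDerivWithinAt_pi, Fin.forall_fin_two]
  beta_reduce
  rw [closedLoopField_apply hG hx,
    closedLoopField_apply hG hx]
  simp [real_inner_comm]

/-- The cosine of the angle between the two agents. -/
noncomputable def cosAngle (Γ : State 2) : ℝ := inner ℝ (Γ 0 : E3) (Γ 1 : E3)

theorem abs_cosAngle_le_one (Γ : State 2) : |cosAngle Γ| ≤ 1 := by
  have h := abs_real_inner_le_norm (Γ 0 : E3) (Γ 1 : E3)
  rwa [norm_eq_of_mem_sphere, norm_eq_of_mem_sphere, one_mul] at h

theorem cosAngle_lt_one {Γ : State 2} (h : Γ 0 ≠ Γ 1) : cosAngle Γ < 1 := by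
  refine lt_of_le_of_ne (abs_le.1 (abs_cosAngle_le_one Γ)).2 fun hc => h ?_
  exact Subtype.ext ((inner_eq_one_iff_of_norm_eq_one (norm_eq_of_mem_sphere _)
    (norm_eq_of_mem_sphere _)).1 hc)

theorem IsTrajectory.hasDerivWithinAt_cosAngle {G : Digraph (Fin 2)}
    (hG : ∀ i, nbrs G i = {i + 1}) {γ : ℝ → State 2} (hγ : IsTrajectory G γ) {t : ℝ}
    (ht : t ∈ Ici (0 : ℝ)) :
    HasDerivWithinAt (fun s => cosAngle (γ s)) (-2 * (1 - cosAngle (γ t) ^ 2)) (Ici 0) t := by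
  obtain ⟨h0, h1⟩ := (isTrajectory_iff hG).1 hγ t ht
  refine (h0.inner ℝ h1).congr_deriv ?_
  simp only [inner_sub_left, inner_sub_right, inner_smul_left, inner_smul_right,
    real_inner_self_eq_norm_sq, norm_eq_of_mem_sphere, cosAngle, conj_trivial]
  ring

theorem IsTrajectory.antitoneOn_cosAngle {G : Digraph (Fin 2)}
    (hG : ∀ i, nbrs G i = {i + 1}) {γ : ℝ → State 2} (hγ : IsTrajectory G γ) :
    AntitoneOn (fun s => cosAngle (γ s)) (Ici 0) := by
  refine antitoneOn_of_hasDerivWithinAt_nonpos (convex_Ici 0)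
    (fun t ht => (hγ.hasDerivWithinAt_cosAngle hG ht).continuousWithinAt)
    (fun t ht => (hγ.hasDerivWithinAt_cosAngle hG (interior_subset ht)).mono interior_subset)
    fun t _ => ?_
  have := (sq_le_one_iff_abs_le_one _).2 (abs_cosAngle_le_one (γ t))
  linarith

theorem IsTrajectory.tendsto_cosAngle {G : Digraph (Fin 2)}
    (hG : ∀ i, nbrs G i = {i + 1}) {γ : ℝ → State 2} (hγ : IsTrajectory G γ)
    (h0 : γ 0 0 ≠ γ 0 1) : Tendsto (fun t => cosAngle (γ t)) atTop (𝓝 (-1)) := by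
  -- Since `c ≤ c(0)`, `(1 + c)' = -2 (1 - c) (1 + c) ≤ -k (1 + c)`, so `exp (k t) * (1 + c)` is
  -- nonincreasing and `1 + c` decays exponentially.
  set k : ℝ := 2 * (1 - cosAngle (γ 0)) with hk
  have hkpos : 0 < k := by linarith [cosAngle_lt_one h0]
  have hd : ∀ t ∈ Ici (0 : ℝ), HasDerivWithinAt (fun s => Real.exp (k * s) * (1 + cosAngle (γ s)))
      (Real.exp (k * t) * (k * 1) * (1 + cosAngle (γ t)) +
        Real.exp (k * t) * (-2 * (1 - cosAngle (γ t) ^ 2))) (Ici 0) t := fun t ht =>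
    (((hasDerivAt_id t).const_mul k).exp.hasDerivWithinAt).mul
      ((hγ.hasDerivWithinAt_cosAngle hG ht).const_add 1)
  have hanti : AntitoneOn (fun s => Real.exp (k * s) * (1 + cosAngle (γ s))) (Ici 0) := by
    refine antitoneOn_of_hasDerivWithinAt_nonpos (convex_Ici 0)
      (fun t ht => (hd t ht).continuousWithinAt)
      (fun t ht => (hd t (interior_subset ht)).mono interior_subset) fun t ht => ?_
    have hle : cosAngle (γ t) ≤ cosAngle (γ 0) :=
      hγ.antitoneOn_cosAngle hG self_mem_Ici (interior_subset ht) (interior_subset ht)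
    have hge := (abs_le.1 (abs_cosAngle_le_one (γ t))).1
    have : Real.exp (k * t) * ((1 + cosAngle (γ t)) * (cosAngle (γ t) - cosAngle (γ 0))) ≤ 0 :=
      mul_nonpos_of_nonneg_of_nonpos (Real.exp_pos _).le
        (mul_nonpos_of_nonneg_of_nonpos (by linarith) (by linarith))
    rw [hk] at this ⊢
    linarith
  have hlim : Tendsto (fun t => -1 + Real.exp (-(k * t)) * (1 + cosAngle (γ 0))) atTop
      (𝓝 (-1)) := by
    have h1 : Tendsto (fun t => Real.exp (-(k * t))) atTop (𝓝 0) :=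
      Real.tendsto_exp_neg_atTop_nhds_zero.comp (tendsto_id.const_mul_atTop hkpos)
    simpa using (h1.mul_const (1 + cosAngle (γ 0))).const_add (-1)
  refine tendsto_of_tendsto_of_tendsto_of_le_of_le' tendsto_const_nhds hlim
    (Eventually.of_forall fun t => (abs_le.1 (abs_cosAngle_le_one (γ t))).1) ?_
  filter_upwards [eventually_ge_atTop 0] with t ht
  have h := hanti self_mem_Ici ht ht
  simp only [mul_zero, Real.exp_zero, one_mul] at h
  have h2 := mul_le_mul_of_nonneg_left h (Real.exp_pos (-(k * t))).le
  rw [← mul_assoc, ← Real.exp_add, neg_add_cancel, Real.exp_zero, one_mul] at h2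
  linarith

/-- The linear system `P' = -Q`, `Q' = -P` has a hyperbolic solution through `(x, y)` in which `P`
and `Q` keep equal norms. Normalising both by the common factor `R` supplies the radial term that
turns the linear field into the projected one. -/
theorem exists_isTrajectory {G : Digraph (Fin 2)} (hG : ∀ i, nbrs G i = {i + 1})
    (Γ : State 2) : ∃ γ : ℝ → State 2, IsTrajectory G γ ∧ γ 0 = Γ := by
  set x : E3 := (Γ 0 : E3) with hx
  set y : E3 := (Γ 1 : E3) with hy
  have hx1 : ‖x‖ = 1 := norm_eq_of_mem_sphere _
  have hy1 : ‖y‖ = 1 := norm_eq_of_mem_sphere _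
  set c : ℝ := inner ℝ x y with hc
  have hcle : |c| ≤ 1 := abs_cosAngle_le_one Γ
  set P : ℝ → E3 := fun t => Real.cosh t • x - Real.sinh t • y with hP
  set Q : ℝ → E3 := fun t => Real.cosh t • y - Real.sinh t • x with hQ
  set N : ℝ → ℝ := fun t => Real.cosh t ^ 2 + Real.sinh t ^ 2 - 2 * c * Real.cosh t * Real.sinh t
    with hN
  have hPd : ∀ t, HasDerivAt P (-Q t) t := fun t => by
    refine (((Real.hasDerivAt_cosh t).smul_const x).sub
      ((Real.hasDerivAt_sinh t).smul_const y)).congr_deriv ?_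
    simp [hQ]
  have hQd : ∀ t, HasDerivAt Q (-P t) t := fun t => by
    refine (((Real.hasDerivAt_cosh t).smul_const y).sub
      ((Real.hasDerivAt_sinh t).smul_const x)).congr_deriv ?_
    simp [hP]
  -- `2 N = (1 - c) exp (2t) + (1 + c) exp (-2t)`, whose coefficients are nonnegative and not both
  -- zero.
  have hNpos : ∀ t, 0 < N t := fun t => by
    have h1 := Real.cosh_sq t
    have h2 := abs_le.1 hcle
    have hm : 0 < Real.cosh t - Real.sinh t := by rw [Real.cosh_sub_sinh]; exact Real.exp_pos _
    have hp : 0 < Real.cosh t + Real.sinh t := by rw [Real.cosh_add_sinh]; exact Real.exp_pos _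
    have hm2 := mul_pos hm hm
    have hp2 := mul_pos hp hp
    simp only [hN]
    rcases le_or_gt c 0 with h | h
    · nlinarith [mul_nonneg (neg_nonneg.2 h) hm2.le, mul_nonneg (by linarith : 0 ≤ 1 + c) hp2.le,
        mul_nonneg (by linarith : 0 ≤ 1 + c) hm2.le]
    · nlinarith [mul_nonneg h.le hp2.le, mul_nonneg (by linarith : 0 ≤ 1 - c) hp2.le,
        mul_nonneg (by linarith : 0 ≤ 1 - c) hm2.le]
  have hPP : ∀ t, inner ℝ (P t) (P t) = N t := fun t => by
    simp only [hP, hN, inner_sub_left, inner_sub_right, inner_smul_left, inner_smul_right,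
      real_inner_self_eq_norm_sq, hx1, hy1, conj_trivial, real_inner_comm x y, ← hc]
    ring
  have hQQ : ∀ t, inner ℝ (Q t) (Q t) = N t := fun t => by
    simp only [hQ, hN, inner_sub_left, inner_sub_right, inner_smul_left, inner_smul_right,
      real_inner_self_eq_norm_sq, hx1, hy1, conj_trivial, real_inner_comm x y, ← hc]
    ring
  set R : ℝ → ℝ := fun t => (√(N t))⁻¹ with hR
  have hR2 : ∀ t, R t * R t * N t = 1 := fun t => by
    have := Real.mul_self_sqrt (hNpos t).le
    have h0 := (Real.sqrt_pos.2 (hNpos t)).ne'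
    simp only [hR]
    nth_rewrite 3 [← this]
    field_simp
  have hRd : ∀ t, HasDerivAt R (R t * (R t * R t * inner ℝ (P t) (Q t))) t := fun t => by
    have h0 := (Real.sqrt_pos.2 (hNpos t)).ne'
    have hNd : HasDerivAt N (-2 * inner ℝ (P t) (Q t)) t := by
      have := (hPd t).inner ℝ (hPd t)
      refine HasDerivAt.congr_deriv (this.congr_of_eventuallyEq
        (Eventually.of_forall fun s => (hPP s).symm)) ?_
      rw [inner_neg_left, inner_neg_right, real_inner_comm (P t) (Q t)]
      ring
    refine ((hNd.sqrt (hNpos t).ne').inv h0).congr_deriv ?_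
    simp only [hR]
    field_simp
  have hnorm : ∀ {v : E3} {t : ℝ}, inner ℝ v v = N t → R t • v ∈ Metric.sphere (0 : E3) 1 := by
    intro v t hv
    rw [mem_sphere_zero_iff_norm, ← sq_eq_sq₀ (norm_nonneg _) zero_le_one,
      ← real_inner_self_eq_norm_sq, inner_smul_left, inner_smul_right, hv, conj_trivial,
      ← mul_assoc, hR2, one_pow]
  refine ⟨fun t => ![⟨R t • P t, hnorm (hPP t)⟩, ⟨R t • Q t, hnorm (hQQ t)⟩], ?_, ?_⟩
  · refine (isTrajectory_iff hG).2 fun t _ => ⟨?_, ?_⟩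
    · refine ((hRd t).smul (hPd t)).hasDerivWithinAt.congr_deriv ?_
      simp only [Matrix.cons_val_zero, Matrix.cons_val_one, inner_smul_left, inner_smul_right,
        conj_trivial]
      module
    · refine ((hRd t).smul (hQd t)).hasDerivWithinAt.congr_deriv ?_
      simp only [Matrix.cons_val_zero, Matrix.cons_val_one, inner_smul_left, inner_smul_right,
        conj_trivial]
      module
  · ext1 i
    fin_cases i <;> ext1 <;> simp [hR, hN, hP, hQ, hx, hy]

theorem antipodalSet_two : antipodalSet 2 = {Γ | Γ 0 = -Γ 1} := by
  ext Γ
  simp only [antipodalSet, mem_ofPred_eq, Fin.forall_fin_two]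
  constructor
  · rintro ⟨v, h0, h1⟩
    refine Subtype.ext ?_
    simp_all
  · intro h
    exact ⟨Γ 0, by simp, by simp [h]⟩

theorem geoDist_eq_angle (x y : S2) : geoDist x y = InnerProductGeometry.angle (x : E3) y := by
  simp [geoDist, InnerProductGeometry.angle]

theorem geoDist_nonneg (x y : S2) : 0 ≤ geoDist x y := Real.arccos_nonneg _

theorem stateDist_nonneg {n : ℕ} (Γ Γ' : State n) : 0 ≤ stateDist Γ Γ' :=
  Real.iSup_nonneg fun _ => geoDist_nonneg _ _

theorem geoDist_le_stateDist {n : ℕ} (Γ Γ' : State n) (i : Fin n) :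
    geoDist (Γ i) (Γ' i) ≤ stateDist Γ Γ' :=
  le_ciSup (f := fun i => geoDist (Γ i) (Γ' i)) (finite_range _).bddAbove i

theorem distTo_nonneg {n : ℕ} (M : Set (State n)) (Γ : State n) : 0 ≤ distTo M Γ :=
  Real.iInf_nonneg fun _ => stateDist_nonneg _ _

theorem distTo_antipodalSet_le (Γ : State 2) :
    distTo (antipodalSet 2) Γ ≤ Real.arccos (-cosAngle Γ) := by
  have hmem : ![Γ 0, -Γ 0] ∈ antipodalSet 2 := by simp [antipodalSet_two]
  refine (ciInf_le ⟨0, ?_⟩ (⟨_, hmem⟩ : antipodalSet 2)).trans (ciSup_le fun i => ?_)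
  · rintro _ ⟨Γ', rfl⟩
    exact stateDist_nonneg _ _
  · fin_cases i
    · simp [geoDist, Real.arccos_nonneg]
    · simp [geoDist, cosAngle, real_inner_comm]

/-- The factor 2 comes from the triangle inequality through a nearby antipodal pair: each of the two
agents contributes an error below `δ`. -/
theorem arccos_neg_cosAngle_lt {Γ : State 2} {δ : ℝ} (h : distTo (antipodalSet 2) Γ < δ) :
    Real.arccos (-cosAngle Γ) < 2 * δ := by
  have hne : Nonempty (antipodalSet 2) :=
    ⟨⟨![Γ 0, -Γ 0], by simp [antipodalSet_two]⟩⟩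
  obtain ⟨⟨Γ', hΓ'⟩, hlt⟩ := exists_lt_of_ciInf_lt h
  have hΓ : Γ' 0 = -Γ' 1 := by simpa [antipodalSet_two] using hΓ'
  have h0 := (geoDist_le_stateDist Γ Γ' 0).trans_lt hlt
  have h1 := (geoDist_le_stateDist Γ Γ' 1).trans_lt hlt
  rw [geoDist_eq_angle] at h0 h1
  have h2 : Real.arccos (-cosAngle Γ) = InnerProductGeometry.angle (Γ 0 : E3) (-(Γ 1 : E3)) := by
    simp [InnerProductGeometry.angle, cosAngle]
  have h3 := InnerProductGeometry.angle_le_angle_add_angle (Γ 0 : E3) (Γ' 0 : E3) (-(Γ 1 : E3))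
  have h4 : InnerProductGeometry.angle (Γ' 0 : E3) (-(Γ 1 : E3)) =
      InnerProductGeometry.angle (Γ 1 : E3) (Γ' 1 : E3) := by
    rw [hΓ, coe_neg_sphere, InnerProductGeometry.angle_neg_neg,
      InnerProductGeometry.angle_comm]
  linarith

theorem isStableSet_antipodalSet {G : Digraph (Fin 2)} (hG : ∀ i, nbrs G i = {i + 1}) :
    IsStableSet G (antipodalSet 2) := by
  refine fun ε hε => ⟨ε / 2, by positivity, fun γ hγ h0 t ht => ?_⟩
  calc distTo (antipodalSet 2) (γ t) ≤ Real.arccos (-cosAngle (γ t)) := distTo_antipodalSet_le _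
    _ ≤ Real.arccos (-cosAngle (γ 0)) :=
      Real.arccos_le_arccos (neg_le_neg (hγ.antitoneOn_cosAngle hG self_mem_Ici ht ht))
    _ < 2 * (ε / 2) := arccos_neg_cosAngle_lt h0
    _ = ε := by ring

theorem subset_regionOfAttraction {G : Digraph (Fin 2)} (hG : ∀ i, nbrs G i = {i + 1}) :
    {Γ : State 2 | Γ 0 ≠ Γ 1} ⊆ regionOfAttraction G (antipodalSet 2) := by
  intro Γ hΓ
  refine ⟨exists_isTrajectory hG Γ, fun γ hγ h0 => ?_⟩
  have hlim : Tendsto (fun t => Real.arccos (-cosAngle (γ t))) atTop (𝓝 0) := by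
    have := (Real.continuous_arccos.tendsto (- -1)).comp
      (hγ.tendsto_cosAngle hG (by rwa [h0])).neg
    simpa [Function.comp_def] using this
  exact squeeze_zero (fun t => distTo_nonneg _ _) (fun t => distTo_antipodalSet_le _) hlim

theorem isAsymptoticallyStable_antipodalSet {G : Digraph (Fin 2)}
    (hG : ∀ i, nbrs G i = {i + 1}) : IsAsymptoticallyStable G (antipodalSet 2) := by
  -- Radius 1 suffices: coinciding agents have `arccos (-c) = π`, which exceeds `2 * 1`.
  refine ⟨isStableSet_antipodalSet hG, 1, one_pos, fun Γ hΓ => ?_⟩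
  refine subset_regionOfAttraction hG fun h => ?_
  have h1 := arccos_neg_cosAngle_lt hΓ
  have h2 : cosAngle Γ = 1 := by
    simp [cosAngle, h]
  rw [h2, Real.arccos_neg_one] at h1
  linarith [Real.pi_gt_three]

/-- The cone over a point lies in a line, which is null in three-space. -/
theorem toSphere_singleton (v : S2) : (volume : Measure E3).toSphere {v} = 0 := by
  rw [Measure.toSphere_apply' _ (measurableSet_singleton v)]
  have hsub : Ioo (0 : ℝ) 1 • ((↑) '' ({v} : Set S2) : Set E3) ⊆
      (Submodule.span ℝ {(v : E3)} : Set E3) := by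
    rw [image_singleton]
    rintro _ ⟨r, -, _, rfl, rfl⟩
    exact Submodule.smul_mem _ _ (Submodule.mem_span_singleton_self _)
  have htop : Submodule.span ℝ {(v : E3)} ≠ ⊤ := by
    intro h
    have h1 := finrank_span_le_card (R := ℝ) ({(v : E3)} : Set E3)
    rw [h, finrank_top, finrank_euclideanSpace] at h1
    simp at h1
  rw [measure_mono_null hsub (Measure.addHaar_submodule _ _ htop), mul_zero]

/-- By Fubini, as every slice of the diagonal is a single point. -/
theorem stateMeasure_diagonal : stateMeasure 2 {Γ : State 2 | Γ 0 ≠ Γ 1}ᶜ = 0 := by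
  have hset : {Γ : State 2 | Γ 0 ≠ Γ 1}ᶜ =
      MeasurableEquiv.finTwoArrow ⁻¹' diagonal S2 := by
    ext Γ
    simp [MeasurableEquiv.finTwoArrow, diagonal]
  rw [hset, stateMeasure, (measurePreserving_finTwoArrow _).measure_preimage
    isClosed_diagonal.measurableSet.nullMeasurableSet,
    Measure.measure_prod_null isClosed_diagonal.measurableSet]
  refine Eventually.of_forall fun x => ?_
  have : Prod.mk x ⁻¹' diagonal S2 = {x} := by
    ext y
    simp [eq_comm]
  beta_reduce
  rw [this]
  exact toSphere_singleton x

end ReducedAttitude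

theorem mainTheorem2 (G : Digraph (Fin 2))
    (hG : ReducedAttitude.IsUndirectedRing G ∨ ReducedAttitude.IsDirectedRing G) :
    ReducedAttitude.antipodalSet 2 = {Γ | Γ 0 = -Γ 1} ∧
    ReducedAttitude.IsAlmostGloballyAsymptoticallyStable G (ReducedAttitude.antipodalSet 2) ∧
    {Γ : ReducedAttitude.State 2 | Γ 0 ≠ Γ 1} ⊆
      ReducedAttitude.regionOfAttraction G (ReducedAttitude.antipodalSet 2) ∧
    ReducedAttitude.stateMeasure 2 {Γ : ReducedAttitude.State 2 | Γ 0 ≠ Γ 1}ᶜ = 0 := by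
  have h := ReducedAttitude.nbrs_eq_of_isRing hG
  have hsub := ReducedAttitude.subset_regionOfAttraction h
  exact ⟨ReducedAttitude.antipodalSet_two,
    ⟨ReducedAttitude.isAsymptoticallyStable_antipodalSet h,
      measure_mono_null (compl_subset_compl.2 hsub) ReducedAttitude.stateMeasure_diagonal⟩,
    hsub, ReducedAttitude.stateMeasure_diagonal⟩
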